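/- Let $\mathbb{T}=\mathbb{R}/\mathbb{Z}$, let $m_{\mathbb{T}^d}$ be Haar probability measure on $\mathbb{T}^d$, and let $T_\alpha(x)=x+\alpha$ for $\alpha\in\mathbb{T}$. A continuous map $f\colon\mathbb{T}\to\mathbb{T}$ is called a measurable but not continuous coboundary over $(\mathbb{T},m_{\mathbb{T}},T_\alpha)$ if the equation $f=F\circ T_\alpha-F$ ($m_{\mathbb{T}}$-almost everywhere) has a Borel measurable solution $F\colon\mathbb{T}\to\mathbb{T}$ but no continuous solution. A system $(X,\mu,T)$ is a homeomorphism $T$ of a compact metric space $X$ together with a $T$-invariant Borel probability measure $\mu$; it is strictly ergodic if $T$ is minimal and $\mu$ is the only $T$-invariant Borel probability measure. Two systems $(X,\mu,T)$ and $(Y,\nu,S)$ are measurably isomorphic if there is a bijection $\pi\colon X\to Y$, measurable with measurable inverse, such that $\pi_*\mu=\nu$ and $S\circ\pi=\pi\circ T$ $\mu$-almost everywhere. Let $k\geq 1$ be an integer and let $\alpha\in\mathbb{T}\setminus(\mathbb{Q}/\mathbb{Z})$. (1) For every integer $j$ with $0<j\leq k$ there is a measurable but not continuous coboundary $f\colon\mathbb{T}\to\mathbb{T}$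 over $(\mathbb{T},m_{\mathbb{T}},T_\alpha)$ such that the system $(\mathbb{T}^k,m_{\mathbb{T}^k},T)$ given by $$T(x_1,\dots,x_k)=(x_1+\alpha,\;x_2+x_1,\;\dots,\;x_j+x_{j-1},\;x_{j+1}+f(x_1)+x_j,\;x_{j+2}+x_{j+1},\;\dots,\;x_k+x_{k-1})$$ (where $f$ does not occur if $j=k$) is strictly ergodic and is measurably isomorphic to $(\mathbb{T}^k,m_{\mathbb{T}^k},S)$, where $$S(x_1,\dots,x_k)=(x_1+\alpha,\;x_2+x_1,\;\dots,\;x_k+x_{k-1}).$$ (2) For every $\beta\in\mathbb{T}\setminus(\mathbb{Q}/\mathbb{Z})$ there is a measurable but not continuous coboundary $g\colon\mathbb{T}\to\mathbb{T}$ over $(\mathbb{T},m_{\mathbb{T}},T_\alpha)$ such that the system $(\mathbb{T}^{k+1},m_{\mathbb{T}^{k+1}},R)$ given by $$R(x_1,\dots,x_{k+1})=(x_1+\alpha,\;x_2+g(x_1)+\beta,\;x_3+x_2,\;\dots,\;x_{k+1}+x_k)$$ is measurably isomorphic to $(\mathbb{T}^{k+1},m_{\mathbb{T}^{k+1}},S')$,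 where $$S'(x_1,\dots,x_{k+1})=(x_1+\alpha,\;x_2+\beta,\;x_3+x_2,\;\dots,\;x_{k+1}+x_k),$$ and such that $(\mathbb{T}^{k+1},m_{\mathbb{T}^{k+1}},R)$ is also strictly ergodic provided that $\alpha$ and $\beta$ are rationally independent, i.e. $m\alpha+n\beta\neq0$ in $\mathbb{T}$ for all $(m,n)\in\mathbb{Z}^2\setminus\{(0,0)\}$. -/

import Mathlib

open MeasureTheory

/-- The circle `ℝ / ℤ`. -/
abbrev Torus : Type := UnitAddCircle

/-- A point of the circle is irrational if it is not the class of a rational number. -/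
def IsIrrationalPoint (α : Torus) : Prop :=
  ∀ q : ℚ, α ≠ (((q : ℝ) : UnitAddCircle))

/-- A dynamical system: a homeomorphism `T` of `X` preserving a Borel probability measure `μ`
(applied below to compact metrizable spaces with their Borel sigma-algebra). -/
structure IsDynSystem {X : Type*} [TopologicalSpace X] [MeasurableSpace X]
    (μ : Measure X) (T : X → X) : Prop where
  isProbabilityMeasure : IsProbabilityMeasure μ
  isHomeomorph : IsHomeomorph T
  measurePreserving : MeasurePreserving T μ μ

/-- Minimality: the only closed invariant subsets are the empty set and the whole space. -/
def IsMinimalMap {X : Type*} [TopologicalSpace X] (T : X → X) : Prop :=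
  ∀ s : Set X, IsClosed s → Set.MapsTo T s s → s = ∅ ∨ s = Set.univ

/-- Unique ergodicity: every invariant probability measure equals `μ`. -/
def IsUniquelyErgodic {X : Type*} [MeasurableSpace X] (μ : Measure X) (T : X → X) : Prop :=
  ∀ ν : Measure X, IsProbabilityMeasure ν → MeasurePreserving T ν ν → ν = μ

/-- A system is strictly ergodic if it is minimal and uniquely ergodic. -/
structure IsStrictlyErgodic {X : Type*} [TopologicalSpace X] [MeasurableSpace X]
    (μ : Measure X) (T : X → X) : Prop where
  isDynSystem : IsDynSystem μ T
  isMinimal : IsMinimalMap T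
  isUniquelyErgodic : IsUniquelyErgodic μ T

/-- Measurable isomorphism of systems: a bijection `π`, measurable in both directions, carrying
`μ` to `ν` and intertwining `T` and `S` at `μ`-almost every point. -/
structure MeasurablyIsomorphic {X Y : Type*} [TopologicalSpace X] [MeasurableSpace X]
    [TopologicalSpace Y] [MeasurableSpace Y]
    (μ : Measure X) (T : X → X) (ν : Measure Y) (S : Y → Y) : Prop where
  source : IsDynSystem μ T
  target : IsDynSystem ν S
  exists_equiv : ∃ π : X ≃ᵐ Y, MeasurePreserving π μ ν ∧ ∀ᵐ x ∂μ, S (π x) = π (T x)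

/-- `F` solves the cohomological equation `ρ = F ∘ T - F` (modulo `μ`). -/
def SolvesCohomological {Y K : Type*} [MeasurableSpace Y] [Sub K]
    (μ : Measure Y) (T : Y → Y) (ρ F : Y → K) : Prop :=
  ∀ᵐ y ∂μ, ρ y = F (T y) - F y

/-- A measurable but not continuous coboundary: `ρ` is continuous, the cohomological equation has
a measurable solution, and it has no continuous solution. -/
structure IsMeasNotContCoboundary {Y K : Type*} [TopologicalSpace Y] [MeasurableSpace Y]
    [TopologicalSpace K] [MeasurableSpace K] [Sub K]
    (μ : Measure Y) (T : Y → Y) (ρ : Y → K) : Prop where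
  continuous : Continuous ρ
  exists_measurable : ∃ F : Y → K, Measurable F ∧ SolvesCohomological μ T ρ F
  not_exists_continuous : ¬ ∃ F : Y → K, Continuous F ∧ SolvesCohomological μ T ρ F

/-- The rotation of the circle by `α`. -/
def circleRotation (α : Torus) : Torus → Torus := fun x => x + α

/-- `(x₁, …, x_k) ↦ (x₁ + α, x₂ + x₁, …, x_k + x_{k-1})`.
The coordinate `x_{i+1}` is `x i` for `i : Fin k`. -/
def affineS {k : ℕ} (α : Torus) (x : Fin k → Torus) : Fin k → Torus := fun i =>
  if i.val = 0 then x i + α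
  else x i + x ⟨i.val - 1, (Nat.sub_le _ _).trans_lt i.isLt⟩

/-- `affineS` with `f x₁` added in the coordinate `j + 1`, for `0 < j`
(for `j = k` there is no such coordinate, and nothing is added). -/
def skewT {k : ℕ} (α : Torus) (f : Torus → Torus) (j : ℕ) (x : Fin k → Torus) :
    Fin k → Torus := fun i =>
  affineS α x i + if i.val = j then f (x ⟨0, i.pos⟩) else 0

/-- `(x₁, …, x_{k+1}) ↦ (x₁ + α, x₂ + β, x₃ + x₂, …, x_{k+1} + x_k)`. -/
def affineS' {k : ℕ} (α β : Torus) (x : Fin (k + 1) → Torus) : Fin (k + 1) → Torus := fun i =>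
  if i.val = 0 then x i + α
  else if i.val = 1 then x i + β
  else x i + x ⟨i.val - 1, (Nat.sub_le _ _).trans_lt i.isLt⟩

/-- `(x₁, …, x_{k+1}) ↦ (x₁ + α, x₂ + g x₁ + β, x₃ + x₂, …, x_{k+1} + x_k)`. -/
def skewR {k : ℕ} (α β : Torus) (g : Torus → Torus) (x : Fin (k + 1) → Torus) :
    Fin (k + 1) → Torus := fun i =>
  if i.val = 0 then x i + α
  else if i.val = 1 then x i + g (x 0) + β
  else x i + x ⟨i.val - 1, (Nat.sub_le _ _).trans_lt i.isLt⟩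

/-! Write `Δ` for `fwdDiff α` and count coordinates from 0. Suppose `f = Δ^K F` almost everywhere
with `F` measurable. Translating each coordinate `i ≥ j` by `-Δ^(K-1-(i-j)) F` of the first
coordinate turns the perturbed map into the affine one: each translating function is the difference
of the next, so what one coordinate passes on is absorbed by its successor (`fwdDiff_tower_eq`).
Depth `K = k` suffices in every case, so a single `f` serves for all `j` and all `β`.

Strict ergodicity passes through this merely measurable conjugacy. An invariant measure projects to
Haar measure on the base, because an irrational rotation is uniquely ergodic; hence the conjugacy
holds almost everywhere for that measure too, and unique ergodicity of the affine map applies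
(`isStrictlyErgodic_skewUnipotent`). The affine case is Fourier analysis with Bessel's inequality
(`integral_mFourier_eq_zero`), and minimality follows from full support.

It remains to find `F` with `Δ^(r+1) F` continuous and `Δ^r F` not almost everywhere equal to a
continuous function (`exists_iterated_coboundary`). Take sums over subsets of a sequence `h n` of
functions with small support and small `Δ^(r+1) (h n)`, but with `Δ^r (h n) = 1/2` on a set of
positive measure. If every such sum failed, there would be uncountably many uniformly separated
points in the separable space `C(Torus, Torus)`. -/

instance isProbabilityMeasure_volume_torus : IsProbabilityMeasure (volume : Measure Torus) :=
  ⟨UnitAddCircle.measure_univ⟩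

/-! ### Characters of the torus and affine unipotent maps -/

/-- The pairing of a character of the torus with a point of the torus. -/
def torusPairing {d : Type*} [Fintype d] (m : d → ℤ) (x : d → Torus) : Torus := ∑ i, m i • x i

theorem torusPairing_add_right {d : Type*} [Fintype d] (m : d → ℤ) (x y : d → Torus) :
    torusPairing m (x + y) = torusPairing m x + torusPairing m y := by
  simp [torusPairing, Finset.sum_add_distrib]

theorem torusPairing_sub_left {d : Type*} [Fintype d] (m m' : d → ℤ) (x : d → Torus) :
    torusPairing (m - m') x = torusPairing m x - torusPairing m' x := by
  simp [torusPairing, Finset.sum_sub_distrib, sub_smul]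

theorem mFourier_eq_toCircle {d : Type*} [Fintype d] (m : d → ℤ) (x : d → Torus) :
    UnitAddTorus.mFourier m x = (AddCircle.toCircle (torusPairing m x) : ℂ) := by
  have h : ∀ s : Finset d, (∏ i ∈ s, fourier (m i) (x i)) =
      (AddCircle.toCircle (∑ i ∈ s, m i • x i) : ℂ) := by
    classical
    intro s
    induction s using Finset.induction_on with
    | empty => simp
    | insert a s ha ih =>
      rw [Finset.prod_insert ha, Finset.sum_insert ha, AddCircle.toCircle_add, ih, fourier_apply,
        Circle.coe_mul]
  exact h Finset.univ

/-- A finite measure on the torus is determined by its Fourier coefficients. -/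
theorem measure_ext_of_integral_mFourier {d : Type*} [Fintype d] {μ ν : Measure (d → Torus)}
    [IsFiniteMeasure μ] [IsFiniteMeasure ν]
    (h : ∀ m : d → ℤ, ∫ x, UnitAddTorus.mFourier m x ∂μ = ∫ x, UnitAddTorus.mFourier m x ∂ν) :
    μ = ν := by
  have key : ∀ f : C(d → Torus, ℂ), ∫ x, f x ∂μ = ∫ x, f x ∂ν := by
    have hint : ∀ (ρ : Measure (d → Torus)) [IsFiniteMeasure ρ] (f : C(d → Torus, ℂ)),
        Integrable f ρ := fun ρ _ f =>
      BoundedContinuousFunction.integrable ρ (BoundedContinuousFunction.mkOfCompact f)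
    have hcont : ∀ (ρ : Measure (d → Torus)) [IsFiniteMeasure ρ],
        Continuous fun f : C(d → Torus, ℂ) => ∫ x, f x ∂ρ := fun ρ _ => by
      have : (fun f : C(d → Torus, ℂ) => ∫ x, f x ∂ρ) =
          fun f => ∫ x, (ContinuousMap.toLp 1 ρ ℂ f) x ∂ρ := by
        funext f
        exact integral_congr_ae (ContinuousMap.coeFn_toLp (p := 1) (𝕜 := ℂ) ρ f).symm
      rw [this]
      exact continuous_integral.comp (ContinuousMap.toLp 1 ρ ℂ).continuous
    intro f
    have hf : f ∈ (Submodule.span ℂ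
        (Set.range (UnitAddTorus.mFourier (d := d)))).topologicalClosure := by
      rw [UnitAddTorus.span_mFourier_closure_eq_top]; trivial
    have hcl : IsClosed {f : C(d → Torus, ℂ) | ∫ x, f x ∂μ = ∫ x, f x ∂ν} :=
      isClosed_eq (hcont μ) (hcont ν)
    refine closure_minimal ?_ hcl hf
    intro g hg
    induction hg using Submodule.span_induction with
    | mem x hx => obtain ⟨m, rfl⟩ := hx; exact h m
    | zero => simp
    | add x y _ _ hx hy =>
      simp only [Set.mem_ofPred_eq, ContinuousMap.add_apply] at *
      rw [integral_add (hint μ x) (hint μ y), integral_add (hint ν x) (hint ν y), hx, hy]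
    | smul c x _ hx =>
      simp only [Set.mem_ofPred_eq, ContinuousMap.smul_apply] at *
      rw [integral_smul, integral_smul, hx]
  refine ext_of_forall_integral_eq_of_IsFiniteMeasure fun f => ?_
  have := key ⟨fun x => (f x : ℂ), by fun_prop⟩
  simp only [ContinuousMap.coe_mk] at this
  rw [integral_complex_ofReal, integral_complex_ofReal] at this
  exact_mod_cast this

/-- The unipotent endomorphism adding to each coordinate of index at least `s` its predecessor. -/
def unipotentHom (n s : ℕ) : (Fin (n + 1) → Torus) →+ (Fin (n + 1) → Torus) where
  toFun x i := x i + if s ≤ i.val then x ⟨i.val - 1, (Nat.sub_le _ _).trans_lt i.isLt⟩ else 0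
  map_zero' := by ext i; simp
  map_add' x y := by
    ext i
    simp only [Pi.add_apply]
    split_ifs <;> abel

theorem unipotentHom_apply (n s : ℕ) (x : Fin (n + 1) → Torus) (i : Fin (n + 1)) :
    unipotentHom n s x i =
      x i + if s ≤ i.val then x ⟨i.val - 1, (Nat.sub_le _ _).trans_lt i.isLt⟩ else 0 := rfl

/-- The action of `unipotentHom` on characters. -/
def unipotentDual (n s : ℕ) (m : Fin (n + 1) → ℤ) : Fin (n + 1) → ℤ := fun i =>
  m i + if h : s ≤ i.val + 1 ∧ i.val + 1 < n + 1 then m ⟨i.val + 1, h.2⟩ else 0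

theorem continuous_unipotentHom (n s : ℕ) : Continuous (unipotentHom n s) := by
  refine continuous_pi fun i => ?_
  simp only [unipotentHom_apply]
  split_ifs <;> fun_prop

theorem torusPairing_unipotentHom {n s : ℕ} (hs : 1 ≤ s) (m : Fin (n + 1) → ℤ)
    (x : Fin (n + 1) → Torus) :
    torusPairing m (unipotentHom n s x) = torusPairing (unipotentDual n s m) x := by
  simp only [torusPairing, unipotentHom_apply, unipotentDual, smul_add, add_smul,
    Finset.sum_add_distrib]
  congr 1
  rw [Fin.sum_univ_succ, Fin.sum_univ_castSucc]
  -- The truncated predecessor of index 0 is 0 itself; `1 ≤ s` switches that term off.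
  have h0 : ¬ s ≤ 0 := by omega
  simp only [Fin.val_zero, h0, if_false, smul_zero, zero_add, Fin.val_succ, Fin.val_last,
    lt_irrefl, and_false, dif_neg, not_false_eq_true, zero_smul, add_zero]
  refine Finset.sum_congr rfl fun i _ => ?_
  by_cases h : s ≤ i.val + 1
  · have h' : s ≤ (i.castSucc).val + 1 ∧ (i.castSucc).val + 1 < n + 1 := by
      constructor
      · simpa using h
      · simp
    rw [if_pos h, dif_pos h']
    rfl
  · have h' : ¬ (s ≤ (i.castSucc).val + 1 ∧ (i.castSucc).val + 1 < n + 1) := by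
      intro hh; exact h (by simpa using hh.1)
    rw [if_neg h, dif_neg h', smul_zero, zero_smul]

theorem iterate_unipotentDual_of_lt {n s : ℕ} {m : Fin (n + 1) → ℤ} {l : ℕ}
    (hm : ∀ i : Fin (n + 1), l < i.val → m i = 0) (r : ℕ) :
    (∀ i : Fin (n + 1), l < i.val → (unipotentDual n s)^[r] m i = 0) ∧
    (∀ i : Fin (n + 1), l = i.val → (unipotentDual n s)^[r] m i = m i) := by
  induction r with
  | zero => exact ⟨hm, fun _ _ => rfl⟩
  | succ r ih =>
    simp only [Function.iterate_succ_apply', unipotentDual]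
    constructor
    · intro i hi
      rw [ih.1 i hi]
      split_ifs with h
      · rw [ih.1 _ (by simp; omega), add_zero]
      · simp
    · intro i hi
      rw [ih.2 i hi]
      split_ifs with h
      · rw [ih.1 _ (by simp; omega), add_zero]
      · simp

/-- The top coefficient is fixed, so the one below it gains the same amount at each step. This
linear growth separates the iterates of a character. -/
theorem iterate_unipotentDual_pred {n s : ℕ} {m : Fin (n + 1) → ℤ} {l : ℕ} (hl : l + 1 < n + 1)
    (hs : s ≤ l + 1) (hm : ∀ i : Fin (n + 1), l + 1 < i.val → m i = 0) (r : ℕ) :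
    (unipotentDual n s)^[r] m ⟨l, by omega⟩ = m ⟨l, by omega⟩ + r * m ⟨l + 1, hl⟩ := by
  induction r with
  | zero => simp
  | succ r ih =>
    have h2 := (iterate_unipotentDual_of_lt (s := s) hm r).2 ⟨l + 1, hl⟩ rfl
    rw [Function.iterate_succ_apply', unipotentDual, ih, dif_pos ⟨hs, hl⟩, h2]
    push_cast
    ring

theorem exists_torusPairing_iterate {n s : ℕ} (hs : 1 ≤ s) (a : Fin (n + 1) → Torus)
    (m : Fin (n + 1) → ℤ) (r : ℕ) :
    ∃ c : Torus, ∀ x, torusPairing m ((fun x => unipotentHom n s x + a)^[r] x) =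
      torusPairing ((unipotentDual n s)^[r] m) x + c := by
  induction r with
  | zero => exact ⟨0, by simp⟩
  | succ r ih =>
    obtain ⟨c, hc⟩ := ih
    refine ⟨torusPairing ((unipotentDual n s)^[r] m) a + c, fun x => ?_⟩
    rw [Function.iterate_succ_apply, hc, torusPairing_add_right, torusPairing_unipotentHom hs,
      Function.iterate_succ_apply', add_assoc]

/-- A character of the base coordinates is an eigenfunction with eigenvalue different from 1. Any
other nontrivial character has infinitely many orthonormal iterates, all with the same integral, so
Bessel's inequality forces that integral to vanish. -/
theorem integral_mFourier_eq_zero {n s : ℕ} (hs : 1 ≤ s) (a : Fin (n + 1) → Torus)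
    (ha : ∀ m : Fin (n + 1) → ℤ, m ≠ 0 → (∀ i, s ≤ i.val → m i = 0) → torusPairing m a ≠ 0)
    (ν : Measure (Fin (n + 1) → Torus)) [IsProbabilityMeasure ν]
    (hν : MeasurePreserving (fun x => unipotentHom n s x + a) ν ν)
    (m : Fin (n + 1) → ℤ) (hm : m ≠ 0) : ∫ x, UnitAddTorus.mFourier m x ∂ν = 0 := by
  set S : (Fin (n + 1) → Torus) → (Fin (n + 1) → Torus) := fun x => unipotentHom n s x + a with hS
  have hSc : Continuous S := (continuous_unipotentHom n s).add continuous_const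
  have hinv : ∀ (m : Fin (n + 1) → ℤ) (r : ℕ),
      ∫ x, UnitAddTorus.mFourier m (S^[r] x) ∂ν = ∫ x, UnitAddTorus.mFourier m x ∂ν := by
    intro m r
    have h := hν.iterate r
    conv_rhs => rw [← h.map_eq]
    rw [integral_map h.measurable.aemeasurable
      (UnitAddTorus.mFourier m).continuous.aestronglyMeasurable]
  have hbase : ∀ m : Fin (n + 1) → ℤ, m ≠ 0 → (∀ i : Fin (n + 1), s ≤ i.val → m i = 0) →
      ∫ x, UnitAddTorus.mFourier m x ∂ν = 0 := by
    intro m hm hms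
    have hdual : unipotentDual n s m = m := by
      ext i
      simp only [unipotentDual, add_eq_left]
      split_ifs with h
      · exact hms _ h.1
      · rfl
    have h1 : ∀ x, UnitAddTorus.mFourier m (S x) =
        UnitAddTorus.mFourier m x * (AddCircle.toCircle (torusPairing m a) : ℂ) := by
      intro x
      rw [mFourier_eq_toCircle, mFourier_eq_toCircle, hS, torusPairing_add_right,
        torusPairing_unipotentHom hs, hdual, AddCircle.toCircle_add, Circle.coe_mul]
    have h2 := hinv m 1
    simp only [Function.iterate_one, h1] at h2
    rw [integral_mul_const] at h2
    have h3 : (AddCircle.toCircle (torusPairing m a) : ℂ) ≠ 1 := by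
      intro h
      apply ha m hm hms
      apply AddCircle.injective_toCircle one_ne_zero
      rw [AddCircle.toCircle_zero]
      exact Circle.ext h
    by_contra h0
    exact h3 (mul_left_cancel₀ h0 (by rw [h2, mul_one]))
  -- Induction on the largest index `l` at which `m` is nonzero.
  have main : ∀ (l : ℕ) (hl : l < n + 1) (m : Fin (n + 1) → ℤ), m ⟨l, hl⟩ ≠ 0 →
      (∀ i : Fin (n + 1), l < i.val → m i = 0) → ∫ x, UnitAddTorus.mFourier m x ∂ν = 0 := by
    intro l
    induction l with
    | zero =>
      intro hl m hml hm
      exact hbase m (fun h => hml (by rw [h]; rfl)) fun i hi => hm i (by omega)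
    | succ l ih =>
      intro hl m hml hm
      by_cases hls : l + 1 < s
      · exact hbase m (fun h => hml (by rw [h]; rfl)) fun i hi => hm i (by omega)
      push Not at hls
      choose c hc using exists_torusPairing_iterate hs a m
      let u : ℕ → C(Fin (n + 1) → Torus, ℂ) := fun r =>
        (UnitAddTorus.mFourier m).comp ⟨S^[r], hSc.iterate r⟩
      have hu : ∀ r x, u r x = (AddCircle.toCircle
          (torusPairing ((unipotentDual n s)^[r] m) x + c r) : ℂ) := fun r x => by
        simp only [u, ContinuousMap.comp_apply, ContinuousMap.coe_mk, mFourier_eq_toCircle, hS, hc]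
      -- For `r ≠ t` the product of one iterate with the conjugate of the other is, up to a
      -- constant, a character with top index `l` and coefficient `(t - r) * m (l + 1)` there; the
      -- induction hypothesis kills its integral.
      have hon : Orthonormal ℂ fun r => ContinuousMap.toLp 2 ν ℂ (u r) := by
        rw [orthonormal_iff_ite]
        intro r t
        rw [ContinuousMap.inner_toLp]
        have hprod : ∀ x, u t x * (starRingEnd ℂ) (u r x) =
            UnitAddTorus.mFourier ((unipotentDual n s)^[t] m - (unipotentDual n s)^[r] m) x *
              (AddCircle.toCircle (c t - c r) : ℂ) := by
          intro x
          rw [hu, hu, mFourier_eq_toCircle, torusPairing_sub_left, ← Circle.coe_inv_eq_conj,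
            ← AddCircle.toCircle_neg, ← Circle.coe_mul, ← Circle.coe_mul, ← AddCircle.toCircle_add,
            ← AddCircle.toCircle_add]
          congr 2
          abel
        simp only [hprod]
        rw [integral_mul_const]
        split_ifs with hrt
        · subst hrt
          simp [UnitAddTorus.mFourier_zero]
        · rw [ih (by omega), zero_mul]
          · rw [Pi.sub_apply, iterate_unipotentDual_pred hl hls hm,
              iterate_unipotentDual_pred hl hls hm]
            have : (t : ℤ) - r ≠ 0 := sub_ne_zero.2 (by exact_mod_cast Ne.symm hrt)
            intro h
            apply mul_ne_zero this hml
            linarith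
          · intro i hi
            rw [Pi.sub_apply]
            rcases Nat.lt_or_eq_of_le (Nat.succ_le_of_lt hi) with h | h
            · rw [(iterate_unipotentDual_of_lt hm t).1 i h,
                (iterate_unipotentDual_of_lt hm r).1 i h, sub_zero]
            · rw [(iterate_unipotentDual_of_lt hm t).2 i h,
                (iterate_unipotentDual_of_lt hm r).2 i h, sub_self]
      have hsum := hon.inner_products_summable (ContinuousMap.toLp 2 ν ℂ 1)
      have hconst : ∀ r, ‖inner ℂ (ContinuousMap.toLp 2 ν ℂ (u r)) (ContinuousMap.toLp 2 ν ℂ 1)‖ =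
          ‖∫ x, UnitAddTorus.mFourier m x ∂ν‖ := by
        intro r
        rw [ContinuousMap.inner_toLp]
        simp only [ContinuousMap.one_apply, one_mul]
        rw [integral_conj, RCLike.norm_conj, ← hinv m r]
        rfl
      simp only [hconst] at hsum
      simpa using (summable_const_iff _).1 hsum
  obtain ⟨i₀, hi₀⟩ := Function.ne_iff.1 hm
  obtain ⟨i, hi, hmax⟩ := Finset.exists_max_image (Finset.univ.filter fun i => m i ≠ 0)
    (fun i => i.val) ⟨i₀, by simpa using hi₀⟩
  refine main i.val i.isLt m (by simpa using hi) fun j hj => ?_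
  by_contra h
  exact absurd (hmax j (by simpa using h)) (by omega)

theorem measurePreserving_unipotentHom {n s : ℕ}
    (hs : Function.Surjective (unipotentHom n s)) (a : Fin (n + 1) → Torus) :
    MeasurePreserving (fun x => unipotentHom n s x + a) volume volume :=
  (measurePreserving_add_right volume a).comp
    (AddMonoidHom.measurePreserving (continuous_unipotentHom n s) hs rfl)

theorem unipotentHom_injective {n s : ℕ} (hs : 1 ≤ s) :
    Function.Injective (unipotentHom n s) := by
  intro x y h
  ext ⟨i, hi⟩
  induction i with
  | zero =>
    have := congrFun h ⟨0, hi⟩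
    have h0 : ¬ s ≤ 0 := by omega
    simpa [unipotentHom_apply, h0] using this
  | succ i ih =>
    have := congrFun h ⟨i + 1, hi⟩
    have h1 := ih (by omega)
    simpa [unipotentHom_apply, h1] using this

theorem unipotentHom_surjective {n s : ℕ} (hs : 1 ≤ s) :
    Function.Surjective (unipotentHom n s) := by
  intro y
  let z : ℕ → Torus := fun i => if h : i < n + 1 then y ⟨i, h⟩ else 0
  -- Forward substitution in a triangular system.
  let u : ℕ → Torus := fun i => Nat.rec (z 0) (fun i v => z (i + 1) - if s ≤ i + 1 then v else 0) i
  have hu : ∀ i, u (i + 1) = z (i + 1) - if s ≤ i + 1 then u i else 0 := fun i => rfl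
  refine ⟨fun i => u i, ?_⟩
  ext ⟨i, hi⟩
  rw [unipotentHom_apply]
  cases i with
  | zero =>
    have h0 : ¬ s ≤ 0 := by omega
    simp [u, z, h0]
  | succ i =>
    simp [hu, z, Nat.lt_of_succ_lt_succ hi]

/-- Affine unipotent maps are uniquely ergodic if no character of the base is invariant. -/
theorem isUniquelyErgodic_unipotentHom_add {n s : ℕ} (hs : 1 ≤ s) (a : Fin (n + 1) → Torus)
    (ha : ∀ m : Fin (n + 1) → ℤ, m ≠ 0 → (∀ i, s ≤ i.val → m i = 0) → torusPairing m a ≠ 0) :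
    IsUniquelyErgodic volume (fun x => unipotentHom n s x + a) := by
  intro ν _ hν
  refine measure_ext_of_integral_mFourier fun m => ?_
  rcases eq_or_ne m 0 with rfl | hm
  · simp [UnitAddTorus.mFourier_zero]
  · rw [integral_mFourier_eq_zero hs a ha ν hν m hm, integral_mFourier_eq_zero hs a ha volume
      (measurePreserving_unipotentHom (unipotentHom_surjective hs) a) m hm]

/-! ### Invariant measures on compact spaces -/

/-- **Krylov–Bogoliubov**: a closed nonempty invariant set of a continuous self-map of a compact
metrizable space carries an invariant probability measure. -/
theorem exists_invariant_measure_of_mapsTo {X : Type*} [MetricSpace X] [CompactSpace X]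
    [MeasurableSpace X] [BorelSpace X] {T : X → X} (hT : Continuous T) {s : Set X}
    (hsc : IsClosed s) (hs : s.Nonempty) (hTs : Set.MapsTo T s s) :
    ∃ ν : Measure X, IsProbabilityMeasure ν ∧ MeasurePreserving T ν ν ∧ ν sᶜ = 0 := by
  obtain ⟨x, hx⟩ := hs
  let e : ℕ → Measure X := fun N =>
    ((N + 1 : ℕ) : ENNReal)⁻¹ • ∑ i ∈ Finset.range (N + 1), Measure.dirac (T^[i] x)
  have he : ∀ N, IsProbabilityMeasure (e N) := fun N => ⟨by
    simp only [e, Measure.smul_apply, Measure.finsetSum_apply, measure_univ, Finset.sum_const,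
      Finset.card_range, smul_eq_mul, nsmul_eq_mul, mul_one]
    exact ENNReal.inv_mul_cancel (by simp) (by simp)⟩
  have hint : ∀ N (f : BoundedContinuousFunction X ℝ), ∫ y, f y ∂(e N) =
      ((N + 1 : ℕ) : ℝ)⁻¹ * ∑ i ∈ Finset.range (N + 1), f (T^[i] x) := by
    intro N f
    simp only [e]
    rw [integral_smul_measure, integral_finsetSum_measure]
    · simp only [ENNReal.toReal_inv, ENNReal.toReal_natCast, integral_dirac, smul_eq_mul]
    · intro i _
      exact f.integrable _
  let P : ℕ → ProbabilityMeasure X := fun N => ⟨e N, he N⟩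
  -- A limit of the orbit averages along a free ultrafilter, by compactness of the space of
  -- probability measures.
  obtain ⟨ν, hν⟩ : ∃ ν : ProbabilityMeasure X, ((Filter.hyperfilter ℕ).map P : Filter _) ≤ nhds ν := by
    obtain ⟨ν, -, h⟩ := isCompact_univ.ultrafilter_le_nhds ((Filter.hyperfilter ℕ).map P) (by simp)
    exact ⟨ν, h⟩
  have htend : Filter.Tendsto P (Filter.hyperfilter ℕ) (nhds ν) := hν
  rw [ProbabilityMeasure.tendsto_iff_forall_integral_tendsto] at htend
  refine ⟨ν, inferInstance, ⟨hT.measurable, ?_⟩, ?_⟩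
  · have : IsProbabilityMeasure (Measure.map T (ν : Measure X)) :=
      Measure.isProbabilityMeasure_map hT.aemeasurable
    refine ext_of_forall_integral_eq_of_IsFiniteMeasure fun f => ?_
    rw [integral_map hT.aemeasurable f.continuous.aestronglyMeasurable]
    let g : BoundedContinuousFunction X ℝ := f.compContinuous ⟨T, hT⟩
    have h1 := (htend g).sub (htend f)
    -- The difference of the two averages telescopes to the two endpoints of the orbit segment.
    have h2 : Filter.Tendsto (fun N => ∫ y, g y ∂(P N : Measure X) - ∫ y, f y ∂(P N : Measure X))
        Filter.atTop (nhds 0) := by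
      have hb : ∀ N, ‖∫ y, g y ∂(P N : Measure X) - ∫ y, f y ∂(P N : Measure X)‖ ≤
          (2 * ‖f‖) * (1 / ((N : ℝ) + 1)) := by
        intro N
        change ‖∫ y, g y ∂(e N) - ∫ y, f y ∂(e N)‖ ≤ _
        rw [hint, hint, ← mul_sub, ← Finset.sum_sub_distrib]
        have : ∀ i, g (T^[i] x) - f (T^[i] x) = f (T^[i + 1] x) - f (T^[i] x) := fun i => by
          rw [Function.iterate_succ_apply']; rfl
        simp only [this]
        rw [Finset.sum_range_sub (fun i => f (T^[i] x)), norm_mul, mul_comm]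
        have h3 : ‖f (T^[N + 1] x) - f (T^[0] x)‖ ≤ 2 * ‖f‖ :=
          (norm_sub_le _ _).trans (by
            linarith [f.norm_coe_le_norm (T^[N + 1] x), f.norm_coe_le_norm (T^[0] x)])
        have h4 : ‖(((N + 1 : ℕ) : ℝ))⁻¹‖ = 1 / ((N : ℝ) + 1) := by
          rw [Real.norm_of_nonneg (by positivity)]; push_cast; rw [one_div]
        rw [h4]
        gcongr
      refine squeeze_zero_norm hb ?_
      simpa using tendsto_one_div_add_atTop_nhds_zero_nat.const_mul (2 * ‖f‖)
    have h3 := tendsto_nhds_unique h1 (h2.mono_left Nat.hyperfilter_le_atTop)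
    exact sub_eq_zero.1 h3
  -- The distance to `s` vanishes along the orbit, hence has integral zero in the limit; it is
  -- positive off the closed set `s`.
  · let f : BoundedContinuousFunction X ℝ := BoundedContinuousFunction.mkOfCompact
      ⟨fun y => Metric.infDist y s, Metric.continuous_infDist_pt s⟩
    have hf : ∀ y, f y = Metric.infDist y s := fun y => rfl
    have hzero : ∀ N, ∫ y, f y ∂(P N : Measure X) = 0 := by
      intro N
      change ∫ y, f y ∂(e N) = 0
      rw [hint]
      refine mul_eq_zero_of_right _ (Finset.sum_eq_zero fun i _ => ?_)
      exact Metric.infDist_zero_of_mem (hTs.iterate i hx)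
    have h1 := htend f
    simp only [hzero] at h1
    have h2 : ∫ y, f y ∂(ν : Measure X) = 0 := tendsto_nhds_unique h1 tendsto_const_nhds |>.symm ▸ rfl
    rw [integral_eq_zero_iff_of_nonneg (f := f) (fun y => Metric.infDist_nonneg) (f.integrable _)] at h2
    refine measure_mono_null (fun y hy => ?_) h2
    have := (hsc.notMem_iff_infDist_pos ⟨x, hx⟩).1 hy
    exact fun h => this.ne' h

/-- A uniquely ergodic map whose invariant measure has full support is minimal. -/
theorem IsUniquelyErgodic.isMinimalMap {X : Type*} [MetricSpace X] [CompactSpace X]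
    [MeasurableSpace X] [BorelSpace X] {μ : Measure X} [μ.IsOpenPosMeasure] {T : X → X}
    (hT : Continuous T) (h : IsUniquelyErgodic μ T) : IsMinimalMap T := by
  intro s hsc hTs
  rcases s.eq_empty_or_nonempty with hs | hs
  · exact Or.inl hs
  · obtain ⟨ν, hν, hTν, h0⟩ := exists_invariant_measure_of_mapsTo hT hsc hs hTs
    rw [h ν hν hTν] at h0
    right
    exact Set.compl_empty_iff.1 ((hsc.isOpen_compl.measure_eq_zero_iff μ).1 h0)

/-! ### Skew products over the first coordinate -/

/-- The translation of the fibres over the first coordinate by a measurable function. -/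
def shearEquiv {n : ℕ} (ψ : Torus → Fin (n + 1) → Torus) (hψ : Measurable ψ)
    (h0 : ∀ t, ψ t 0 = 0) : (Fin (n + 1) → Torus) ≃ᵐ (Fin (n + 1) → Torus) where
  toFun x := x + ψ (x 0)
  invFun x := x - ψ (x 0)
  left_inv x := by simp [h0]
  right_inv x := by simp [h0]
  measurable_toFun := by
    simp only [Equiv.coe_fn_mk]
    exact measurable_id.add (hψ.comp (measurable_pi_apply 0))
  measurable_invFun := by
    simp only [Equiv.coe_fn_symm_mk]
    exact measurable_id.sub (hψ.comp (measurable_pi_apply 0))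

theorem shearEquiv_apply {n : ℕ} {ψ : Torus → Fin (n + 1) → Torus} (hψ : Measurable ψ)
    (h0 : ∀ t, ψ t 0 = 0) (x : Fin (n + 1) → Torus) :
    shearEquiv ψ hψ h0 x = x + ψ (x 0) := rfl

/-- Fubini: the first coordinate is fixed, and each fibre over it is translated. -/
theorem measurePreserving_shearEquiv {n : ℕ} {ψ : Torus → Fin (n + 1) → Torus}
    (hψ : Measurable ψ) (h0 : ∀ t, ψ t 0 = 0) :
    MeasurePreserving (shearEquiv ψ hψ h0) volume volume := by
  have he := volume_preserving_piFinSuccAbove (fun _ : Fin (n + 1) => Torus) 0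
  set e := MeasurableEquiv.piFinSuccAbove (fun _ : Fin (n + 1) => Torus) 0 with he'
  have hg : MeasurePreserving (fun p : Torus × (Fin n → Torus) =>
      (id p.1, p.2 + fun i : Fin n => ψ p.1 i.succ)) (volume.prod volume)
      (volume.prod volume) := by
    refine MeasurePreserving.skew_product (MeasurePreserving.id volume)
      (g := fun t y => y + fun i : Fin n => ψ t i.succ) ?_ ?_
    · refine measurable_snd.add (measurable_pi_lambda _ fun i => ?_)
      exact (measurable_pi_apply i.succ).comp (hψ.comp measurable_fst)
    · exact Filter.Eventually.of_forall fun t =>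
        (measurePreserving_add_right volume (fun i : Fin n => ψ t i.succ)).map_eq
  have h := (he.symm e).comp (hg.comp he)
  have heq : ⇑(shearEquiv ψ hψ h0) = e.symm ∘ (fun p : Torus × (Fin n → Torus) =>
      (id p.1, p.2 + fun i : Fin n => ψ p.1 i.succ)) ∘ e := ?_
  · rw [heq]
    exact h
  funext x
  apply e.injective
  simp only [Function.comp_apply, MeasurableEquiv.apply_symm_apply]
  refine Prod.ext ?_ ?_
  · change x 0 + ψ (x 0) 0 = x 0
    rw [h0, add_zero]
  · rfl

/-- The skew product adding `ψ x₀` to an affine unipotent map. -/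
def skewUnipotent (n s : ℕ) (a : Fin (n + 1) → Torus) (ψ : Torus → Fin (n + 1) → Torus)
    (x : Fin (n + 1) → Torus) : Fin (n + 1) → Torus :=
  unipotentHom n s x + a + ψ (x 0)

theorem unipotentHom_apply_zero {n s : ℕ} (hs : 1 ≤ s) (x : Fin (n + 1) → Torus) :
    unipotentHom n s x 0 = x 0 := by
  have h0 : ¬ s ≤ 0 := by omega
  simp [unipotentHom_apply, h0]

theorem isDynSystem_skewUnipotent {n s : ℕ} (hs : 1 ≤ s) (a : Fin (n + 1) → Torus)
    {ψ : Torus → Fin (n + 1) → Torus} (hψ : Continuous ψ) (h0 : ∀ t, ψ t 0 = 0) :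
    IsDynSystem volume (skewUnipotent n s a ψ) := by
  -- Bijectivity and invariance of the measure are read off from this factorization; compactness
  -- then gives the homeomorphism.
  have heq : skewUnipotent n s a ψ = (fun x => x + a) ∘
      (shearEquiv ψ hψ.measurable h0) ∘ unipotentHom n s := by
    funext x
    simp only [Function.comp_apply, shearEquiv_apply, skewUnipotent, unipotentHom_apply_zero hs]
    abel
  refine ⟨⟨measure_univ⟩, ?_, ?_⟩
  · rw [isHomeomorph_iff_continuous_bijective]
    constructor
    · exact ((continuous_unipotentHom n s).add continuous_const).add
        (hψ.comp (continuous_apply 0))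
    · rw [heq]
      exact (Equiv.addRight a).bijective.comp ((shearEquiv ψ hψ.measurable h0).bijective.comp
        ⟨unipotentHom_injective hs, unipotentHom_surjective hs⟩)
  · rw [heq]
    exact (measurePreserving_add_right volume a).comp
      ((measurePreserving_shearEquiv hψ.measurable h0).comp
        (AddMonoidHom.measurePreserving (continuous_unipotentHom n s)
          (unipotentHom_surjective hs) rfl))

theorem skewUnipotent_zero (n s : ℕ) (a : Fin (n + 1) → Torus) :
    skewUnipotent n s a (fun _ => 0) = fun x => unipotentHom n s x + a := by
  funext x
  simp [skewUnipotent]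

/-- The fibre translation by `-Φ` conjugates the skew product to the affine map over the points
where the cohomological equation holds. -/
theorem shearEquiv_neg_conj {n s : ℕ} (hs : 1 ≤ s) (a : Fin (n + 1) → Torus)
    {ψ Φ : Torus → Fin (n + 1) → Torus} (hΦ : Measurable Φ)
    (hψ0 : ∀ t, ψ t 0 = 0) (hΦ0 : ∀ t, (-Φ) t 0 = 0) (x : Fin (n + 1) → Torus)
    (hx : ψ (x 0) = Φ (x 0 + a 0) - unipotentHom n s (Φ (x 0))) :
    unipotentHom n s (shearEquiv (-Φ) hΦ.neg hΦ0 x) + a =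
      shearEquiv (-Φ) hΦ.neg hΦ0 (skewUnipotent n s a ψ x) := by
  have h : skewUnipotent n s a ψ x 0 = x 0 + a 0 := by
    simp [skewUnipotent, hψ0, unipotentHom_apply_zero hs]
  rw [shearEquiv_apply, shearEquiv_apply, h, skewUnipotent, hx, map_add]
  simp only [Pi.neg_apply, map_neg]
  abel

theorem measurablyIsomorphic_skewUnipotent {n s : ℕ} (hs : 1 ≤ s) (a : Fin (n + 1) → Torus)
    {ψ Φ : Torus → Fin (n + 1) → Torus} (hψ : Continuous ψ) (hΦ : Measurable Φ)
    (hψ0 : ∀ t, ψ t 0 = 0) (hΦ0 : ∀ t, Φ t 0 = 0)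
    (h : ∀ᵐ t : Torus, ψ t = Φ (t + a 0) - unipotentHom n s (Φ t)) :
    MeasurablyIsomorphic volume (skewUnipotent n s a ψ) volume
      (fun x => unipotentHom n s x + a) := by
  have hΦ0' : ∀ t, (-Φ) t 0 = 0 := fun t => by simp [hΦ0]
  refine ⟨isDynSystem_skewUnipotent hs a hψ hψ0, ?_, shearEquiv (-Φ) hΦ.neg hΦ0',
    measurePreserving_shearEquiv _ _, ?_⟩
  · rw [← skewUnipotent_zero]
    exact isDynSystem_skewUnipotent hs a continuous_const fun _ => rfl
  · have he : MeasurePreserving (fun x : Fin (n + 1) → Torus => x 0) volume volume :=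
      measurePreserving_eval (fun _ : Fin (n + 1) => (volume : Measure Torus)) 0
    filter_upwards [he.quasiMeasurePreserving.ae h] with x hx
    exact shearEquiv_neg_conj hs a hΦ hψ0 hΦ0' x hx

theorem isUniquelyErgodic_add_right {α : Torus} (hα : ∀ m : ℤ, m ≠ 0 → m • α ≠ 0) :
    IsUniquelyErgodic (volume : Measure Torus) (fun t => t + α) := by
  intro ν _ hν
  let c : Torus → Fin 1 → Torus := fun t _ => t
  have hc : Measurable c := measurable_pi_lambda _ fun _ => measurable_id
  have hue := isUniquelyErgodic_unipotentHom_add (n := 0) le_rfl (fun _ => α) (by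
    intro m hm _
    rw [torusPairing, Fin.sum_univ_one]
    exact hα _ fun h => hm (by ext i; rw [Subsingleton.elim (α := Fin 1) i 0, h]; rfl))
  have hS : ∀ t, unipotentHom 0 1 (c t) + (fun _ => α) = c (t + α) := by
    intro t
    ext i
    have : i = 0 := Subsingleton.elim _ _
    subst this
    simp [unipotentHom_apply, c]
  have h1 := hue (Measure.map c ν) (Measure.isProbabilityMeasure_map hc.aemeasurable) ⟨?_, ?_⟩
  · have he : MeasurePreserving (fun x : Fin 1 → Torus => x 0) volume volume :=
      measurePreserving_eval (fun _ : Fin 1 => (volume : Measure Torus)) 0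
    rw [← he.map_eq, ← h1, Measure.map_map he.measurable hc]
    exact Measure.map_id.symm
  · exact ((continuous_unipotentHom 0 1).add continuous_const).measurable
  · have hm : Measurable fun x => unipotentHom 0 1 x + fun _ => α :=
      ((continuous_unipotentHom 0 1).add continuous_const).measurable
    rw [Measure.map_map hm hc]
    have : (fun x => unipotentHom 0 1 x + (fun _ => α)) ∘ c = c ∘ fun t => t + α := funext hS
    rw [this, ← Measure.map_map hc hν.measurable, hν.map_eq]

/-- The cohomological equation may fail on a Haar-null set of the base. Every invariant measure
projects to Haar measure there, so the preimage of that set is null for it as well, and the shear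
carries it to an invariant measure of the affine map. -/
theorem isStrictlyErgodic_skewUnipotent {n s : ℕ} (hs : 1 ≤ s) (a : Fin (n + 1) → Torus)
    (ha : ∀ m : Fin (n + 1) → ℤ, m ≠ 0 → (∀ i, s ≤ i.val → m i = 0) → torusPairing m a ≠ 0)
    {ψ Φ : Torus → Fin (n + 1) → Torus} (hψ : Continuous ψ) (hΦ : Measurable Φ)
    (hψ0 : ∀ t, ψ t 0 = 0) (hΦ0 : ∀ t, Φ t 0 = 0)
    (h : ∀ᵐ t : Torus, ψ t = Φ (t + a 0) - unipotentHom n s (Φ t)) :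
    IsStrictlyErgodic volume (skewUnipotent n s a ψ) := by
  have hdyn := isDynSystem_skewUnipotent hs a hψ hψ0
  have hue : IsUniquelyErgodic volume (skewUnipotent n s a ψ) := by
    intro ν hν hinv
    have hbase : IsUniquelyErgodic (volume : Measure Torus) (fun t => t + a 0) := by
      -- Characters of coordinate 0 alone are among those covered by `ha`, since `1 ≤ s`.
      refine isUniquelyErgodic_add_right fun m hm => ?_
      have := ha (Pi.single 0 m) (by simpa using hm) fun i hi =>
        Pi.single_eq_of_ne (fun h => by subst h; simp at hi; omega) _
      rwa [torusPairing, Finset.sum_eq_single 0, Pi.single_eq_same] at this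
      · intro b _ hb
        simp [Pi.single_eq_of_ne hb]
      · simp
    have he : Measurable fun x : Fin (n + 1) → Torus => x 0 := measurable_pi_apply 0
    have hmap : Measure.map (fun x : Fin (n + 1) → Torus => x 0) ν = volume := by
      refine hbase _ (Measure.isProbabilityMeasure_map he.aemeasurable)
        ⟨measurable_add_const _, ?_⟩
      rw [Measure.map_map (measurable_add_const _) he]
      have : (fun t => t + a 0) ∘ (fun x : Fin (n + 1) → Torus => x 0) =
          (fun x => x 0) ∘ skewUnipotent n s a ψ := by
        funext x
        simp [skewUnipotent, hψ0, unipotentHom_apply_zero hs]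
      rw [this, ← Measure.map_map he hinv.measurable, hinv.map_eq]
    have hΦ0' : ∀ t, (-Φ) t 0 = 0 := fun t => by simp [hΦ0]
    set π := shearEquiv (-Φ) hΦ.neg hΦ0'
    have hS : Measurable fun x => unipotentHom n s x + a :=
      ((continuous_unipotentHom n s).add continuous_const).measurable
    have hconj : (fun x => unipotentHom n s x + a) ∘ π =ᵐ[ν] π ∘ skewUnipotent n s a ψ := by
      filter_upwards [(MeasurePreserving.quasiMeasurePreserving ⟨he, hmap⟩).ae h] with x hx
      exact shearEquiv_neg_conj hs a hΦ hψ0 hΦ0' x hx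
    have hπ : Measure.map π ν = volume := by
      refine isUniquelyErgodic_unipotentHom_add hs a ha _
        (Measure.isProbabilityMeasure_map π.measurable.aemeasurable) ⟨hS, ?_⟩
      rw [Measure.map_map hS π.measurable, Measure.map_congr hconj,
        ← Measure.map_map π.measurable hinv.measurable, hinv.map_eq]
    have hvol := (measurePreserving_shearEquiv hΦ.neg hΦ0').map_eq
    exact π.map_measurableEquiv_injective (hπ.trans hvol.symm)
  exact ⟨hdyn, hue.isMinimalMap hdyn.isHomeomorph.continuous, hue⟩

/-- Iterated coboundaries solve the cohomological equation of the unipotent tower. -/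
theorem fwdDiff_tower_eq {n s j K : ℕ} (hj : 0 < j) (hsj : s ≤ j + 1) (hK : n + 1 ≤ K + j) (hK1 : 1 ≤ K)
    (α : Torus) (F : Torus → Torus) (t : Torus) (i : Fin (n + 1)) :
    (if i.val = j then (fwdDiff α)^[K] F t else 0) =
      (if j ≤ i.val then (fwdDiff α)^[K - 1 - (i.val - j)] F (t + α) else 0) -
        unipotentHom n s
          (fun i => if j ≤ i.val then (fwdDiff α)^[K - 1 - (i.val - j)] F t else 0) i := by
  obtain ⟨i, hi⟩ := i
  simp only [unipotentHom_apply]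
  rcases lt_trichotomy i j with h | h | h
  · have h1 : ¬ i = j := by omega
    have h2 : ¬ j ≤ i := by omega
    have h3 : ¬ j ≤ i - 1 := by omega
    simp [h1, h2, h3]
  -- The predecessor of coordinate `j` carries no correction, so the equation is `Δ^K F = Δ (Δ^(K-1)
  -- F)`.
  · subst h
    obtain ⟨K, rfl⟩ : ∃ L, K = L + 1 := ⟨K - 1, by omega⟩
    have h3 : ¬ i ≤ i - 1 := by omega
    simp [h3, Function.iterate_succ_apply', fwdDiff]
  -- Here `hK` keeps the exponent from being truncated, so the predecessor has exactly one more
  -- difference.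
  · obtain ⟨r, hr⟩ : ∃ r, K - 1 - (i - j) = r := ⟨_, rfl⟩
    have hr' : K - 1 - (i - 1 - j) = r + 1 := by omega
    have h1 : ¬ i = j := by omega
    have h2 : j ≤ i := by omega
    have h3 : j ≤ i - 1 := by omega
    have h4 : s ≤ i := by omega
    simp [h1, h2, h3, h4, hr, hr', Function.iterate_succ_apply', fwdDiff]

/-! ### Small functions with large iterated differences -/

section PolynomialCoefficients

open Polynomial

theorem abs_coeff_X_pow_sub_one_mul_le {Q : ℝ[X]} {C : ℝ} (hQ : ∀ j, |Q.coeff j| ≤ C) (M j : ℕ) :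
    |((X ^ M - 1) * Q).coeff j| ≤ 2 * C := by
  have hC : 0 ≤ C := (abs_nonneg _).trans (hQ 0)
  rw [sub_mul, one_mul, coeff_sub, coeff_X_pow_mul']
  have h := hQ j
  split_ifs with h1
  · have h2 := hQ (j - M)
    rw [abs_le] at *
    constructor <;> linarith
  · rw [abs_le] at *
    constructor <;> linarith

theorem abs_coeff_X_pow_sub_one_pow_mul_le {Q : ℝ[X]} {C : ℝ} (hQ : ∀ j, |Q.coeff j| ≤ C)
    (M r j : ℕ) : |((X ^ M - 1) ^ r * Q).coeff j| ≤ 2 ^ r * C := by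
  induction r generalizing j with
  | zero => simpa using hQ j
  | succ r ih =>
    rw [pow_succ' (X ^ M - 1 : ℝ[X]), mul_assoc, pow_succ' (2 : ℝ), mul_assoc]
    exact abs_coeff_X_pow_sub_one_mul_le ih M j

theorem coeff_X_pow_sub_one_pow_mul_of_lt (Q : ℝ[X]) {M j : ℕ} (hj : j < M) (r : ℕ) :
    ((X ^ M - 1) ^ r * Q).coeff j = (-1) ^ r * Q.coeff j := by
  induction r with
  | zero => simp
  | succ r ih =>
    rw [pow_succ' (X ^ M - 1 : ℝ[X]), mul_assoc, sub_mul, one_mul, coeff_sub, coeff_X_pow_mul',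
      if_neg (by omega), ih]
    ring

theorem coeff_geom_sum (M j : ℕ) :
    (∑ i ∈ Finset.range M, (X : ℝ[X]) ^ i).coeff j = if j < M then 1 else 0 := by
  simp [coeff_X_pow]

theorem coeff_geom_sum_sq {M : ℕ} (hM : 0 < M) :
    ((∑ i ∈ Finset.range M, (X : ℝ[X]) ^ i) ^ 2).coeff (M - 1) = M := by
  rw [sq, coeff_mul, Finset.sum_congr rfl (g := fun _ => (1 : ℝ))]
  · simp [Finset.Nat.card_antidiagonal, Nat.sub_add_cancel hM]
  · intro p hp
    rw [Finset.HasAntidiagonal.mem_antidiagonal] at hp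
    rw [coeff_geom_sum, coeff_geom_sum, if_pos (by omega), if_pos (by omega), one_mul]

/-- Take `U = 1 + X + ⋯ + X^(M-1)`, so that `(X - 1) * U = X^M - 1`, and let `P` be a multiple of
`U^(r+2)`. Then `(X - 1)^(r+1) * P` retains one factor `U`, with bounded coefficients, whereas `(X -
1)^r * P` retains `U^2`, with a coefficient of size `M`. Normalizing the latter makes the former of
order `1/M`. -/
theorem exists_polynomial_small_diff (r : ℕ) {ε : ℝ} (hε : 0 < ε) :
    ∃ P : ℝ[X], (∀ j, |((X - 1) ^ (r + 1) * P).coeff j| ≤ ε) ∧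
      ∃ j, ((X - 1) ^ r * P).coeff j = 1 / 2 := by
  obtain ⟨N, hN⟩ := exists_nat_gt (2 ^ (r + 1) / ε)
  set M := N + 1
  have hM : 0 < M := Nat.succ_pos N
  have hM' : (0 : ℝ) < M := by exact_mod_cast hM
  have hMε : 2 ^ (r + 1) < ε * M := by
    rw [div_lt_iff₀ hε] at hN
    have : (M : ℝ) = N + 1 := by simp [M]
    rw [this]; nlinarith
  set U : ℝ[X] := ∑ i ∈ Finset.range M, X ^ i
  have hU : (X - 1) * U = X ^ M - 1 := by rw [mul_comm]; exact geom_sum_mul X M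
  set c : ℝ := (-1) ^ r / (2 * M) with hc
  have hcabs : |c| = 1 / (2 * M) := by
    rw [hc, abs_div, abs_pow, abs_neg, abs_one, one_pow, abs_of_pos (by positivity)]
  refine ⟨C c * U ^ (r + 2), fun j => ?_, M - 1, ?_⟩
  · have h : (X - 1) ^ (r + 1) * (C c * U ^ (r + 2)) = C c * ((X ^ M - 1) ^ (r + 1) * U) := by
      rw [← hU, mul_pow]; ring
    have hUb : ∀ j, |U.coeff j| ≤ 1 := fun j => by
      rw [coeff_geom_sum]; split_ifs <;> simp
    rw [h, coeff_C_mul, abs_mul, hcabs]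
    have := abs_coeff_X_pow_sub_one_pow_mul_le hUb M (r + 1) j
    rw [one_div, inv_mul_le_iff₀ (by positivity)]
    nlinarith
  · have h : (X - 1) ^ r * (C c * U ^ (r + 2)) = C c * ((X ^ M - 1) ^ r * U ^ 2) := by
      rw [← hU, mul_pow]; ring
    rw [h, coeff_C_mul, coeff_X_pow_sub_one_pow_mul_of_lt _ (by omega), coeff_geom_sum_sq hM, hc]
    have : ((-1 : ℝ) ^ r) * (-1) ^ r = 1 := by rw [← mul_pow]; simp
    field_simp
    linear_combination this

end PolynomialCoefficients

/-- The translation operator on real functions on the circle. -/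
def shiftEnd (α : Torus) : Module.End ℝ (Torus → ℝ) := LinearMap.funLeft ℝ ℝ (fun x => x + α)

theorem shiftEnd_pow_apply (α : Torus) (g : Torus → ℝ) (i : ℕ) (x : Torus) :
    (shiftEnd α ^ i) g x = g (x + i • α) := by
  induction i generalizing x with
  | zero => simp
  | succ i ih =>
    rw [pow_succ', Module.End.mul_apply]
    change (shiftEnd α ^ i) g (x + α) = _
    rw [ih, succ_nsmul', add_assoc]

theorem aeval_shiftEnd_apply (α : Torus) (g : Torus → ℝ) {P : Polynomial ℝ} {D : ℕ}
    (hP : P.natDegree ≤ D) (x : Torus) :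
    Polynomial.aeval (shiftEnd α) P g x =
      ∑ i ∈ Finset.range (D + 1), P.coeff i * g (x + i • α) := by
  rw [Polynomial.aeval_eq_sum_range' (Nat.lt_succ_of_le hP), LinearMap.sum_apply, Finset.sum_apply]
  simp [shiftEnd_pow_apply]

theorem fwdDiff_iterate_aeval_shiftEnd (α : Torus) (g : Torus → ℝ) (P : Polynomial ℝ) (r : ℕ) :
    (fwdDiff α)^[r] (Polynomial.aeval (shiftEnd α) P g) =
      Polynomial.aeval (shiftEnd α) ((Polynomial.X - 1) ^ r * P) g := by
  induction r with
  | zero => simp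
  | succ r ih =>
    rw [Function.iterate_succ_apply', ih, pow_succ', mul_assoc,
      map_mul (Polynomial.aeval (shiftEnd α)) (Polynomial.X - 1), map_sub, Polynomial.aeval_X,
      map_one]
    rfl

/-- Translates of a small ball are disjoint, so `P` of the translation operator acts on functions
supported there through its coefficients. -/
theorem aeval_shiftEnd_apply_of_mem {α : Torus} {g : Torus → ℝ} {V : Set Torus} {D : ℕ}
    (hV : ∀ x, ∀ i ≤ D, ∀ j ≤ D, x + i • α ∈ V → x + j • α ∈ V → i = j)
    (hg : ∀ x, x ∉ V → g x = 0) {P : Polynomial ℝ} (hP : P.natDegree ≤ D) {x : Torus} {i : ℕ}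
    (hi : i ≤ D) (hx : x + i • α ∈ V) :
    Polynomial.aeval (shiftEnd α) P g x = P.coeff i * g (x + i • α) := by
  rw [aeval_shiftEnd_apply α g hP, Finset.sum_eq_single i]
  · intro j hj hji
    rw [hg, mul_zero]
    exact fun h => hji (hV x j (Nat.lt_succ_iff.1 (Finset.mem_range.1 hj)) i hi h hx)
  · intro h
    exact absurd (Finset.mem_range.2 (Nat.lt_succ_of_le hi)) h

theorem exists_ball_translates_disjoint {α : Torus} (hα : ∀ m : ℤ, m ≠ 0 → m • α ≠ 0) (D : ℕ)
    {ε : ℝ} (hε : 0 < ε) : ∃ r : ℝ, 0 < r ∧ r ≤ ε ∧ ∀ x : Torus, ∀ i ≤ D, ∀ j ≤ D,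
      x + i • α ∈ Metric.ball (0 : Torus) r → x + j • α ∈ Metric.ball (0 : Torus) r → i = j := by
  have h1 : ∀ᶠ r : ℝ in nhdsWithin 0 (Set.Ioi 0),
      ∀ p ∈ Finset.range (D + 1) ×ˢ Finset.range (D + 1), p.1 ≠ p.2 →
        r < ‖((p.1 : ℤ) - p.2) • α‖ / 2 := by
    rw [Filter.eventually_all_finset]
    intro p _
    by_cases hp : p.1 = p.2
    · simp [hp]
    · have : 0 < ‖((p.1 : ℤ) - p.2) • α‖ / 2 := by
        have := hα ((p.1 : ℤ) - p.2) (sub_ne_zero.2 (by exact_mod_cast hp))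
        positivity
      filter_upwards [nhdsWithin_le_nhds (gt_mem_nhds this)] with r hr _ using hr
  have h2 : ∀ᶠ r : ℝ in nhdsWithin 0 (Set.Ioi 0), r ≤ ε := by
    filter_upwards [nhdsWithin_le_nhds (gt_mem_nhds hε)] with r hr using hr.le
  obtain ⟨r, ⟨hr1, hr2⟩, hr0⟩ := ((h1.and h2).and self_mem_nhdsWithin).exists
  refine ⟨r, hr0, hr2, fun x i hi j hj hxi hxj => ?_⟩
  by_contra hij
  have h3 := hr1 (i, j) (by simp; omega) hij
  rw [mem_ball_zero_iff] at hxi hxj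
  have h4 : ((i : ℤ) - j) • α = (x + i • α) - (x + j • α) := by
    rw [sub_smul, natCast_zsmul, natCast_zsmul]; abel
  simp only at h3
  rw [h4] at h3
  have := norm_sub_le (x + i • α) (x + j • α)
  linarith

/-- Apply the polynomial to the shift operator and a bump function on a tiny ball. As the relevant
translates of the ball are disjoint, values of the differences are single coefficients times values
of the bump. -/
theorem exists_small_function {α : Torus} (hα : ∀ m : ℤ, m ≠ 0 → m • α ≠ 0) (r : ℕ)
    {ε : ℝ} (hε : 0 < ε) :
    ∃ h : Torus → ℝ, Continuous h ∧ (∀ x, |(fwdDiff α)^[r + 1] h x| ≤ ε) ∧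
      (∃ W : Set Torus, volume W ≤ ENNReal.ofReal ε ∧
        ∀ i ≤ r + 1, ∀ x, x ∉ W → h (x + i • α) = 0) ∧
      0 < volume {x | (fwdDiff α)^[r] h x = 1 / 2} := by
  obtain ⟨P, hP1, j₀, hj₀⟩ := exists_polynomial_small_diff r hε
  -- This range covers the shifts in `P` and the further `r + 1` shifts from differencing.
  set D := P.natDegree + (r + 1) with hD
  have hdeg : ∀ i ≤ r + 1, ((Polynomial.X - 1) ^ i * P).natDegree ≤ D := by
    intro i hi
    refine Polynomial.natDegree_mul_le.trans ?_
    have : ((Polynomial.X - 1 : Polynomial ℝ) ^ i).natDegree ≤ i := by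
      refine Polynomial.natDegree_pow_le.trans ?_
      rw [← Polynomial.C_1, Polynomial.natDegree_X_sub_C, mul_one]
    omega
  have hj₀D : j₀ ≤ D := by
    by_contra h
    rw [Polynomial.coeff_eq_zero_of_natDegree_lt] at hj₀
    · norm_num at hj₀
    · exact (hdeg r (by omega)).trans_lt (by omega)
  -- With this radius the `D + 1` translates have total measure at most `ε`.
  obtain ⟨ρ, hρ, hρε, hV⟩ := exists_ball_translates_disjoint hα D
    (show 0 < ε / (2 * (D + 1)) by positivity)
  set V := Metric.ball (0 : Torus) ρ
  -- The plateau of height 1 on the half ball makes `Δ^r` equal to `1/2` on a nonempty open set.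
  set g : Torus → ℝ := fun x => max 0 (min 1 (2 - 2 * ‖x‖ / ρ)) with hg
  have hgc : Continuous g := by
    have : ρ ≠ 0 := hρ.ne'
    fun_prop
  have hg0 : ∀ x, x ∉ V → g x = 0 := by
    intro x hx
    rw [mem_ball_zero_iff, not_lt] at hx
    refine max_eq_left ((min_le_right _ _).trans ?_)
    have : 1 ≤ ‖x‖ / ρ := (one_le_div hρ).2 hx
    rw [mul_div_assoc]
    linarith
  have hgb : ∀ x, |g x| ≤ 1 := fun x => by
    rw [abs_of_nonneg (le_max_left _ _)]
    exact max_le zero_le_one (min_le_left _ _)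
  have hg1 : ∀ x ∈ Metric.ball (0 : Torus) (ρ / 2), g x = 1 := by
    intro x hx
    rw [mem_ball_zero_iff] at hx
    have : ‖x‖ / ρ ≤ 1 / 2 := by rw [div_le_iff₀ hρ]; linarith
    simp only [hg]
    rw [min_eq_left, max_eq_right zero_le_one]
    rw [mul_div_assoc]
    linarith
  refine ⟨Polynomial.aeval (shiftEnd α) P g, ?_, fun x => ?_, ⟨⋃ i ∈ Finset.range (D + 1),
    (fun x => x + i • α) ⁻¹' V, ?_, ?_⟩, ?_⟩
  · have : Polynomial.aeval (shiftEnd α) P g = fun x =>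
        ∑ i ∈ Finset.range (P.natDegree + 1), P.coeff i * g (x + i • α) :=
      funext (aeval_shiftEnd_apply α g le_rfl)
    rw [this]
    fun_prop
  · rw [fwdDiff_iterate_aeval_shiftEnd]
    by_cases h : ∃ i ≤ D, x + i • α ∈ V
    · obtain ⟨i, hi, hx⟩ := h
      rw [aeval_shiftEnd_apply_of_mem hV hg0 (hdeg _ le_rfl) hi hx, abs_mul]
      exact (mul_le_of_le_one_right (abs_nonneg _) (hgb _)).trans (hP1 i)
    · push Not at h
      rw [aeval_shiftEnd_apply α g (hdeg _ le_rfl), Finset.sum_eq_zero, abs_zero]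
      · exact hε.le
      · intro i hi
        rw [hg0 _ (h i (Nat.lt_succ_iff.1 (Finset.mem_range.1 hi))), mul_zero]
  · refine (measure_biUnion_finset_le _ _).trans ?_
    have hvol : ∀ i ∈ Finset.range (D + 1), volume ((fun x : Torus => x + i • α) ⁻¹' V) ≤
        ENNReal.ofReal (ε / (D + 1)) := by
      intro i _
      rw [measure_preimage_add_right]
      refine (measure_mono Metric.ball_subset_closedBall).trans ?_
      rw [AddCircle.volume_closedBall]
      refine ENNReal.ofReal_le_ofReal ((min_le_right _ _).trans ?_)
      calc 2 * ρ ≤ 2 * (ε / (2 * (D + 1))) := by gcongr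
        _ = ε / (D + 1) := by field_simp
    refine (Finset.sum_le_card_nsmul _ _ _ hvol).trans ?_
    rw [Finset.card_range, nsmul_eq_mul, ← ENNReal.ofReal_natCast, ← ENNReal.ofReal_mul (by positivity)]
    refine ENNReal.ofReal_le_ofReal (le_of_eq ?_)
    push_cast
    field_simp
  · intro i hi x hx
    rw [aeval_shiftEnd_apply α g le_rfl, Finset.sum_eq_zero]
    intro j hj
    rw [hg0, mul_zero]
    intro h
    apply hx
    simp only [Set.mem_iUnion, Set.mem_preimage]
    refine ⟨i + j, ?_, ?_⟩
    · rw [Finset.mem_range] at *; omega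
    · rwa [add_smul, ← add_assoc]
  · have hopen : IsOpen ((fun x : Torus => x + j₀ • α) ⁻¹' Metric.ball 0 (ρ / 2)) :=
      Metric.isOpen_ball.preimage (by fun_prop)
    refine (hopen.measure_pos volume ⟨-(j₀ • α), by simp [hρ]⟩).trans_le (measure_mono ?_)
    intro x hx
    rw [Set.mem_preimage] at hx
    rw [Set.mem_ofPred_eq, fwdDiff_iterate_aeval_shiftEnd, aeval_shiftEnd_apply_of_mem hV hg0
      (hdeg _ (by omega)) hj₀D (Metric.ball_subset_ball (by linarith) hx), hj₀, hg1 _ hx, mul_one]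

/-! ### Iterated measurable coboundaries -/

/-- Each bound `e n` is chosen after all earlier functions, so that the later exceptional sets
together cannot cover the set where `Δ^r (h m) = 1/2`. The factor 3 beats the geometric tail bound
`2 * e (m + 1)` strictly. -/
theorem exists_small_function_seq {α : Torus} (hα : ∀ m : ℤ, m ≠ 0 → m • α ≠ 0) (r : ℕ) :
    ∃ (h : ℕ → Torus → ℝ) (W : ℕ → Set Torus) (e : ℕ → ℝ),
      (∀ n, Continuous (h n)) ∧ (∀ n, 0 < e n) ∧ (∀ m n, m < n → e n ≤ e m / 2) ∧
      (∀ n x, |(fwdDiff α)^[r + 1] (h n) x| ≤ e n) ∧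
      (∀ n, volume (W n) ≤ ENNReal.ofReal (e n)) ∧
      (∀ n, ∀ i ≤ r + 1, ∀ x, x ∉ W n → h n (x + i • α) = 0) ∧
      (∀ m n, m < n →
        3 * ENNReal.ofReal (e n) ≤ volume {x | (fwdDiff α)^[r] (h m) x = 1 / 2}) := by
  obtain ⟨u, hu, hru⟩ := exists_seq_of_forall_finset_exists
    (fun p : (Torus → ℝ) × Set Torus × ℝ => Continuous p.1 ∧ 0 < p.2.2 ∧
      (∀ x, |(fwdDiff α)^[r + 1] p.1 x| ≤ p.2.2) ∧ volume p.2.1 ≤ ENNReal.ofReal p.2.2 ∧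
      (∀ i ≤ r + 1, ∀ x, x ∉ p.2.1 → p.1 (x + i • α) = 0) ∧
      0 < volume {x | (fwdDiff α)^[r] p.1 x = 1 / 2})
    (fun p q => q.2.2 ≤ p.2.2 / 2 ∧
      3 * ENNReal.ofReal q.2.2 ≤ volume {x | (fwdDiff α)^[r] p.1 x = 1 / 2}) (by
    intro s hs
    have h1 : ∀ᶠ e : ℝ in nhdsWithin 0 (Set.Ioi 0), ∀ p ∈ s, e ≤ p.2.2 / 2 ∧
        3 * ENNReal.ofReal e ≤ volume {x | (fwdDiff α)^[r] p.1 x = 1 / 2} := by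
      rw [Filter.eventually_all_finset]
      intro p hp
      obtain ⟨-, hp0, -, -, -, hpv⟩ := hs p hp
      have h2 : Filter.Tendsto (fun e : ℝ => 3 * ENNReal.ofReal e) (nhds 0) (nhds 0) := by
        have := ENNReal.Tendsto.const_mul (a := 3) (ENNReal.tendsto_ofReal (Filter.tendsto_id
          (α := ℝ) (x := nhds 0))) (Or.inr (by simp))
        simpa using this
      refine nhdsWithin_le_nhds ?_
      filter_upwards [gt_mem_nhds (half_pos hp0), h2.eventually (gt_mem_nhds hpv)] with e he he'
      exact ⟨le_of_lt he, le_of_lt he'⟩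
    obtain ⟨e, he, he0⟩ := (h1.and self_mem_nhdsWithin).exists
    obtain ⟨h, hc, hb, ⟨W, hW, hhW⟩, hv⟩ := exists_small_function hα r he0
    exact ⟨(h, W, e), ⟨hc, he0, hb, hW, hhW, hv⟩, he⟩)
  exact ⟨fun n => (u n).1, fun n => (u n).2.1, fun n => (u n).2.2, fun n => (hu n).1,
    fun n => (hu n).2.1, fun m n hmn => (hru m n hmn).1, fun n => (hu n).2.2.1,
    fun n => (hu n).2.2.2.1, fun n => (hu n).2.2.2.2.1, fun m n hmn => (hru m n hmn).2⟩

theorem measurable_fwdDiff_iterate {G : Type*} [AddCommGroup G] [MeasurableSpace G]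
    [MeasurableSub₂ G] (α : Torus) {F : Torus → G} (hF : Measurable F) (i : ℕ) :
    Measurable ((fwdDiff α)^[i] F) := by
  induction i with
  | zero => exact hF
  | succ i ih =>
    rw [Function.iterate_succ_apply']
    exact (ih.comp (measurable_add_const α)).sub ih

theorem continuous_fwdDiff_iterate {G : Type*} [AddCommGroup G] [TopologicalSpace G]
    [IsTopologicalAddGroup G] (α : Torus) {F : Torus → G} (hF : Continuous F) (i : ℕ) :
    Continuous ((fwdDiff α)^[i] F) := by
  induction i with
  | zero => exact hF
  | succ i ih =>
    rw [Function.iterate_succ_apply']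
    exact (ih.comp (continuous_add_const α)).sub ih

theorem fwdDiff_iterate_coe (α : Torus) (F : Torus → ℝ) (i : ℕ) :
    (fwdDiff α)^[i] (fun x => (F x : Torus)) = fun x => (((fwdDiff α)^[i] F x : ℝ) : Torus) := by
  induction i with
  | zero => rfl
  | succ i ih =>
    rw [Function.iterate_succ_apply', Function.iterate_succ_apply', ih]
    funext x
    simp [fwdDiff]

theorem fwdDiff_iterate_congr {G : Type*} [AddCommGroup G] {α : Torus} {F F' : Torus → G} {i : ℕ}
    {x : Torus} (h : ∀ k ≤ i, F (x + k • α) = F' (x + k • α)) :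
    (fwdDiff α)^[i] F x = (fwdDiff α)^[i] F' x := by
  rw [fwdDiff_iter_eq_sum_shift, fwdDiff_iter_eq_sum_shift]
  refine Finset.sum_congr rfl fun k hk => ?_
  rw [h k (Nat.lt_succ_iff.1 (Finset.mem_range.1 hk))]

/-- Series of functions that are eventually zero along an orbit may be differenced termwise. -/
theorem fwdDiff_iterate_tsum {α : Torus} {r : ℕ} {h : ℕ → Torus → ℝ} {W : ℕ → Set Torus}
    (hW : ∀ n, ∀ i ≤ r, ∀ x, x ∉ W n → h n (x + i • α) = 0) (c : ℕ → ℝ) {x : Torus} {N : ℕ}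
    (hx : ∀ n, N ≤ n → x ∉ W n) {i : ℕ} (hi : i ≤ r) :
    (fwdDiff α)^[i] (fun y => ∑' n, c n * h n y) x =
      ∑ n ∈ Finset.range N, c n * (fwdDiff α)^[i] (h n) x := by
  have h1 : (fwdDiff α)^[i] (fun y => ∑' n, c n * h n y) x =
      (fwdDiff α)^[i] (∑ n ∈ Finset.range N, c n • h n) x := by
    refine fwdDiff_iterate_congr fun k hk => ?_
    simp only [Finset.sum_apply, Pi.smul_apply, smul_eq_mul]
    refine tsum_eq_sum fun n hn => ?_
    rw [hW n k (hk.trans hi) x (hx n (by simpa using hn)), mul_zero]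
  rw [h1, fwdDiff_iter_finsetSum, Finset.sum_apply]
  simp only [fwdDiff_iter_const_smul, Pi.smul_apply, smul_eq_mul]

theorem exists_iterated_coboundary {α : Torus} (hα : ∀ m : ℤ, m ≠ 0 → m • α ≠ 0) (r : ℕ) :
    ∃ f F : Torus → Torus, Continuous f ∧ Measurable F ∧
      (∀ᵐ t : Torus, f t = (fwdDiff α)^[r + 1] F t) ∧
      ¬ ∃ G : Torus → Torus, Continuous G ∧ (fwdDiff α)^[r] F =ᵐ[volume] G := by
  obtain ⟨h, W, e, hc, he0, hemono, hbd, hvol, hW, hmeas⟩ := exists_small_function_seq hα r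
  have hgeom : ∀ n i, e (n + i) ≤ e n * (1 / 2) ^ i := by
    intro n i
    induction i with
    | zero => simp
    | succ i ih =>
      have := hemono (n + i) (n + (i + 1)) (by omega)
      rw [pow_succ]; linarith
  have hsum : Summable e := by
    refine Summable.of_nonneg_of_le (fun n => (he0 n).le) (fun n => ?_)
      (summable_geometric_two.mul_left (e 0))
    simpa using hgeom 0 n
  have htail : ∀ n, volume (⋃ m, ⋃ (_ : n < m), W m) <
      volume {x | (fwdDiff α)^[r] (h n) x = 1 / 2} := by
    intro n
    have h1 : (⋃ m, ⋃ (_ : n < m), W m) ⊆ ⋃ i, W (n + 1 + i) := by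
      intro x hx
      simp only [Set.mem_iUnion] at hx ⊢
      obtain ⟨m, hm, hx⟩ := hx
      exact ⟨m - (n + 1), by rwa [Nat.add_sub_cancel' hm]⟩
    have h2 : volume (⋃ m, ⋃ (_ : n < m), W m) ≤ ENNReal.ofReal (2 * e (n + 1)) := by
      refine (measure_mono h1).trans ((measure_iUnion_le _).trans ?_)
      have h3 : Summable fun i : ℕ => e (n + 1) * (1 / 2 : ℝ) ^ i :=
        summable_geometric_two.mul_left _
      rw [mul_comm, ← tsum_geometric_two, ← tsum_mul_left,
        ENNReal.ofReal_tsum_of_nonneg (fun i => mul_nonneg (he0 _).le (by positivity)) h3]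
      exact ENNReal.tsum_le_tsum fun i => (hvol _).trans (ENNReal.ofReal_le_ofReal (hgeom _ _))
    refine h2.trans_lt (lt_of_lt_of_le ?_ (hmeas n (n + 1) (Nat.lt_succ_self n)))
    rw [show (3 : ENNReal) = ENNReal.ofReal 3 by simp, ← ENNReal.ofReal_mul (by norm_num)]
    have := he0 (n + 1)
    exact (ENNReal.ofReal_lt_ofReal_iff (by positivity)).2 (by linarith)
  -- Borel–Cantelli: almost everywhere the series for `F` and its differences are finite sums.
  have hgood : ∀ᵐ x : Torus, ∃ N, ∀ n, N ≤ n → x ∉ W n := by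
    have h1 : ∑' n, volume (W n) ≠ ⊤ := by
      refine ne_top_of_le_ne_top ?_ (ENNReal.tsum_le_tsum hvol)
      rw [← ENNReal.ofReal_tsum_of_nonneg (fun n => (he0 n).le) hsum]
      exact ENNReal.ofReal_ne_top
    filter_upwards [ae_eventually_notMem h1] with x hx
    exact Filter.eventually_atTop.1 hx
  -- One candidate for each subset of the sequence, encoded by `σ`.
  let c : (ℕ → Bool) → ℕ → ℝ := fun σ n => if σ n then 1 else 0
  have hcabs : ∀ σ n, |c σ n| ≤ 1 := fun σ n => by simp only [c]; split_ifs <;> simp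
  let F : (ℕ → Bool) → Torus → ℝ := fun σ x => ∑' n, c σ n * h n x
  let f : (ℕ → Bool) → Torus → ℝ := fun σ x => ∑' n, c σ n * (fwdDiff α)^[r + 1] (h n) x
  have hF : ∀ σ, Measurable (F σ) := fun σ =>
    Measurable.tsum fun n => (hc n).measurable.const_mul _
  have hf : ∀ σ, Continuous (f σ) := fun σ => by
    refine continuous_tsum (fun n => (continuous_fwdDiff_iterate α (hc n) _).const_mul _) hsum
      fun n x => ?_
    rw [norm_mul, Real.norm_eq_abs, Real.norm_eq_abs]
    exact (mul_le_of_le_one_left (abs_nonneg _) (hcabs σ n)).trans (hbd n x)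
  have hfF : ∀ σ, ∀ᵐ x : Torus, f σ x = (fwdDiff α)^[r + 1] (F σ) x := fun σ => by
    filter_upwards [hgood] with x ⟨N, hN⟩
    rw [fwdDiff_iterate_tsum hW (c σ) hN le_rfl]
    refine tsum_eq_sum fun n hn => ?_
    have h0 : (fwdDiff α)^[r + 1] (h n) x = (fwdDiff α)^[r + 1] (fun _ => (0 : ℝ)) x :=
      fwdDiff_iterate_congr fun k hk => hW n k hk x (hN n (by simpa using hn))
    rw [h0, Function.iterate_succ_apply, fwdDiff_const, fwdDiff_iter_eq_sum_shift]
    simp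
  have hsep : ∀ (σ τ : ℕ → Bool), σ ≠ τ → ∀ G G' : C(Torus, Torus),
      (fwdDiff α)^[r] (fun x => (F σ x : Torus)) =ᵐ[volume] G →
      (fwdDiff α)^[r] (fun x => (F τ x : Torus)) =ᵐ[volume] G' → 1 / 2 ≤ dist G G' := by
    intro σ τ hne G G' hG hG'
    have hex : ∃ n, σ n ≠ τ n := Function.ne_iff.1 hne
    set n := Nat.find hex
    have hn : σ n ≠ τ n := Nat.find_spec hex
    have hlt : ∀ m < n, σ m = τ m := fun m hm => by
      by_contra hh; exact Nat.find_min hex hm hh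
    -- At such points, with `n` the first index where `σ` and `τ` differ, earlier terms cancel and
    -- later ones vanish; only `±1/2` from term `n` remains. Its norm in the circle is `1/2`.
    have hpos : volume ({x | (fwdDiff α)^[r] (h n) x = 1 / 2} \ ⋃ m, ⋃ (_ : n < m), W m) ≠ 0 := by
      intro h0
      refine (htail n).not_ge (measure_mono_ae ?_)
      filter_upwards [measure_eq_zero_iff_ae_notMem.1 h0] with x hx hxA
      exact by_contra fun hxW => hx ⟨hxA, hxW⟩
    obtain ⟨x, ⟨hxA, hxW⟩, hxG, hxG'⟩ : ∃ x, x ∈ ({x | (fwdDiff α)^[r] (h n) x = 1 / 2} \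
        ⋃ m, ⋃ (_ : n < m), W m) ∧ (fwdDiff α)^[r] (fun x => (F σ x : Torus)) x = G x ∧
        (fwdDiff α)^[r] (fun x => (F τ x : Torus)) x = G' x := by
      by_contra hcon
      push Not at hcon
      apply hpos
      refine measure_mono_null ?_ (ae_iff.1 (hG.and hG'))
      intro x hx hh
      exact hcon x hx hh.1 hh.2
    have hN : ∀ m, n + 1 ≤ m → x ∉ W m := fun m hm hh =>
      hxW (Set.mem_iUnion₂.2 ⟨m, hm, hh⟩)
    have hd : (fwdDiff α)^[r] (F σ) x - (fwdDiff α)^[r] (F τ) x = (c σ n - c τ n) * (1 / 2) := by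
      rw [fwdDiff_iterate_tsum hW (c σ) hN (Nat.le_succ r),
        fwdDiff_iterate_tsum hW (c τ) hN (Nat.le_succ r), Finset.sum_range_succ,
        Finset.sum_range_succ, Finset.sum_congr rfl fun m hm => by
          rw [show c σ m = c τ m by simp only [c, hlt m (Finset.mem_range.1 hm)]]]
      rw [show (fwdDiff α)^[r] (h n) x = 1 / 2 from hxA]
      ring
    refine le_trans (le_of_eq ?_) (ContinuousMap.dist_apply_le_dist x)
    rw [← hxG, ← hxG', fwdDiff_iterate_coe, fwdDiff_iterate_coe, dist_eq_norm,
      ← AddCircle.coe_sub, hd]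
    have hhalf : ‖((1 / 2 : ℝ) : Torus)‖ = 1 / 2 := by
      have := AddCircle.norm_half_period_eq (p := (1 : ℝ))
      simpa using this
    cases h1 : σ n <;> cases h2 : τ n <;> simp_all [c]
  by_cases hall : ∀ σ, ∃ G : C(Torus, Torus),
      (fwdDiff α)^[r] (fun x => (F σ x : Torus)) =ᵐ[volume] G
  · exfalso
    choose G hG using hall
    -- Disjoint balls of radius `1/4` in the separable space `C(Torus, Torus)`, contradicting
    -- Cantor's theorem.
    have hcount : (Set.univ : Set (ℕ → Bool)).Countable := by
      refine Set.PairwiseDisjoint.countable_of_isOpen (s := fun σ => Metric.ball (G σ) (1 / 4))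
        ?_ (fun _ _ => Metric.isOpen_ball) fun σ _ => ⟨G σ, Metric.mem_ball_self (by norm_num)⟩
      intro σ _ τ _ hne
      refine Metric.ball_disjoint_ball ?_
      have := hsep σ τ hne _ _ (hG σ) (hG τ)
      linarith
    obtain ⟨ι, hι⟩ := (Set.countable_univ_iff.1 hcount).exists_injective_nat
    classical
    refine Function.cantor_injective (fun s : Set ℕ => ι fun n => decide (n ∈ s)) fun s t hst => ?_
    ext n
    simpa using congrFun (hι hst) n
  · push Not at hall
    obtain ⟨σ, hσ⟩ := hall
    refine ⟨fun x => (f σ x : Torus), fun x => (F σ x : Torus),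
      (AddCircle.continuous_mk' 1).comp (hf σ), AddCircle.measurable_mk'.comp (hF σ), ?_, ?_⟩
    · filter_upwards [hfF σ] with x hx
      rw [fwdDiff_iterate_coe, hx]
    · rintro ⟨G, hGc, hG⟩
      exact hσ ⟨G, hGc⟩ hG

/-- Two measurable solutions differ by an invariant function, constant by ergodicity. A continuous
solution would thus make `Δ^r F` continuous up to a null set. -/
theorem exists_iterated_isMeasNotContCoboundary {α : Torus}
    (hα : ∀ m : ℤ, m ≠ 0 → m • α ≠ 0) (r : ℕ) :
    ∃ f F : Torus → Torus, IsMeasNotContCoboundary volume (circleRotation α) f ∧ Measurable F ∧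
      ∀ᵐ t : Torus, f t = (fwdDiff α)^[r + 1] F t := by
  obtain ⟨f, F, hf, hF, hfF, hno⟩ := exists_iterated_coboundary hα r
  have hFr := measurable_fwdDiff_iterate α hF r
  have hfF' : ∀ᵐ t : Torus,
      f t = (fwdDiff α)^[r] F (circleRotation α t) - (fwdDiff α)^[r] F t := by
    filter_upwards [hfF] with t ht
    rw [ht, Function.iterate_succ_apply']
    rfl
  refine ⟨f, F, ⟨hf, ⟨_, hFr, hfF'⟩, ?_⟩, hF, hfF⟩
  rintro ⟨G, hGc, hG⟩
  have herg : Ergodic (fun t : Torus => t + α) volume := by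
    rw [AddCircle.ergodic_add_right, addOrderOf_eq_zero_iff']
    intro n hn
    rw [← natCast_zsmul]
    exact hα n (by exact_mod_cast hn.ne')
  obtain ⟨c, hc⟩ := herg.ae_eq_const_of_ae_eq_comp_ae
    (g := fun t => (fwdDiff α)^[r] F t - G t) (hFr.sub hGc.measurable).aestronglyMeasurable (by
      filter_upwards [hfF', hG] with t h1 h2
      rw [h1, circleRotation] at h2
      simp only [Function.comp_apply]
      rw [sub_eq_sub_iff_add_eq_add] at h2 ⊢
      rw [h2, add_comm])
  refine hno ⟨fun t => G t + c, hGc.add continuous_const, ?_⟩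
  filter_upwards [hc] with t ht
  rw [← sub_eq_iff_eq_add']
  exact ht

/-! ### The main theorem -/

theorem zsmul_ne_zero_of_isIrrationalPoint {α : Torus} (hα : IsIrrationalPoint α) (m : ℤ)
    (hm : m ≠ 0) : m • α ≠ 0 := by
  intro h
  induction α using QuotientAddGroup.induction_on with
  | H a =>
    change m • ((a : ℝ) : UnitAddCircle) = 0 at h
    rw [← AddCircle.coe_zsmul, AddCircle.coe_eq_zero_iff] at h
    obtain ⟨l, hl⟩ := h
    refine hα (l / m : ℚ) ?_
    change ((a : ℝ) : UnitAddCircle) = _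
    congr 1
    have : (m : ℝ) ≠ 0 := by exact_mod_cast hm
    simp only [zsmul_eq_mul, mul_one] at hl
    push_cast
    rw [eq_div_iff this, hl, mul_comm]

/-- A skew product over an affine unipotent map by an iterated coboundary, in the coordinate of
index `j`, is isomorphic to the affine map, and strictly ergodic if the affine map is. -/
theorem skewUnipotent_single {n s j K : ℕ} (hs : 1 ≤ s) (hj : 0 < j) (hsj : s ≤ j + 1)
    (hK : n + 1 ≤ K + j) (hK1 : 1 ≤ K) {a : Fin (n + 1) → Torus} {f F : Torus → Torus}
    (hf : Continuous f) (hF : Measurable F) (hfF : ∀ᵐ t : Torus, f t = (fwdDiff (a 0))^[K] F t) :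
    MeasurablyIsomorphic volume
        (skewUnipotent n s a fun t i => if i.val = j then f t else 0) volume
        (fun x => unipotentHom n s x + a) ∧
      ((∀ m : Fin (n + 1) → ℤ, m ≠ 0 → (∀ i, s ≤ i.val → m i = 0) → torusPairing m a ≠ 0) →
        IsStrictlyErgodic volume
          (skewUnipotent n s a fun t i => if i.val = j then f t else 0)) := by
  set ψ : Torus → Fin (n + 1) → Torus := fun t i => if i.val = j then f t else 0
  set Φ : Torus → Fin (n + 1) → Torus := fun t i =>
    if j ≤ i.val then (fwdDiff (a 0))^[K - 1 - (i.val - j)] F t else 0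
  have hψ : Continuous ψ := by
    refine continuous_pi fun i => ?_
    by_cases h : i.val = j
    · simpa [ψ, h] using hf
    · simpa [ψ, h] using continuous_const
  have hΦ : Measurable Φ := by
    refine measurable_pi_lambda _ fun i => ?_
    by_cases h : j ≤ i.val
    · simpa [Φ, h] using measurable_fwdDiff_iterate (a 0) hF _
    · simp [Φ, h]
  have hψ0 : ∀ t, ψ t 0 = 0 := fun t => by simp [ψ, hj.ne]
  have hΦ0 : ∀ t, Φ t 0 = 0 := fun t => by simp [Φ, hj.ne']
  have hcoh : ∀ᵐ t : Torus, ψ t = Φ (t + a 0) - unipotentHom n s (Φ t) := by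
    filter_upwards [hfF] with t ht
    ext i
    simp only [ψ, ht, Pi.sub_apply]
    exact fwdDiff_tower_eq hj hsj hK hK1 (a 0) F t i
  exact ⟨measurablyIsomorphic_skewUnipotent hs a hψ hΦ hψ0 hΦ0 hcoh,
    fun ha => isStrictlyErgodic_skewUnipotent hs a ha hψ hΦ hψ0 hΦ0 hcoh⟩

theorem affineS_eq (n : ℕ) (α : Torus) :
    affineS (k := n + 1) α = fun x => unipotentHom n 1 x + Pi.single 0 α := by
  funext x i
  simp only [affineS, Pi.add_apply, unipotentHom_apply]
  by_cases h : i = 0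
  · subst h; simp
  · have h1 : i.val ≠ 0 := fun h' => h (Fin.ext h')
    have h2 : 1 ≤ i.val := by omega
    simp [h, h1, h2, Pi.single_eq_of_ne]

theorem skewT_eq (n : ℕ) (α : Torus) (f : Torus → Torus) (j : ℕ) :
    skewT (k := n + 1) α f j = skewUnipotent n 1 (Pi.single 0 α)
      fun t i => if i.val = j then f t else 0 := by
  funext x i
  simp only [skewT, affineS_eq, skewUnipotent, Pi.add_apply]
  rfl

/-- The translation part of `affineS'`. -/
def translationS' (n : ℕ) (α β : Torus) : Fin (n + 1) → Torus := fun i =>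
  if i.val = 0 then α else if i.val = 1 then β else 0

theorem affineS'_eq (n : ℕ) (α β : Torus) :
    affineS' (k := n) α β = fun x => unipotentHom n 2 x + translationS' n α β := by
  funext x i
  simp only [affineS', Pi.add_apply, unipotentHom_apply, translationS']
  by_cases h0 : i.val = 0
  · simp [h0]
  · by_cases h1 : i.val = 1
    · simp [h1]
    · have h2 : 2 ≤ i.val := by omega
      simp [h0, h1, h2]

theorem skewR_eq (n : ℕ) (α β : Torus) (g : Torus → Torus) :
    skewR (k := n) α β g = skewUnipotent n 2 (translationS' n α β)
      fun t i => if i.val = 1 then g t else 0 := by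
  funext x i
  simp only [skewR, skewUnipotent, Pi.add_apply, unipotentHom_apply, translationS']
  by_cases h0 : i.val = 0
  · simp [h0]
  · by_cases h1 : i.val = 1
    · simp [h1]; abel
    · have h2 : 2 ≤ i.val := by omega
      simp [h0, h1, h2]

theorem torusPairing_single_ne_zero {n : ℕ} {α : Torus} (hα : ∀ m : ℤ, m ≠ 0 → m • α ≠ 0)
    (m : Fin (n + 1) → ℤ) (hm : m ≠ 0) (h : ∀ i, 1 ≤ i.val → m i = 0) :
    torusPairing m (Pi.single 0 α) ≠ 0 := by
  have h0 : m 0 ≠ 0 := by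
    intro h0
    apply hm
    ext i
    by_cases hi : i = 0
    · rw [hi, h0]; rfl
    · exact h i (Nat.one_le_iff_ne_zero.2 fun h' => hi (Fin.ext h'))
  rw [torusPairing, Finset.sum_eq_single 0, Pi.single_eq_same]
  · exact hα _ h0
  · intro b _ hb
    rw [Pi.single_eq_of_ne hb, smul_zero]
  · simp

theorem torusPairing_translationS'_ne_zero {n : ℕ} {α β : Torus}
    (hαβ : LinearIndependent ℤ ![α, β]) (m : Fin (n + 2) → ℤ) (hm : m ≠ 0)
    (h : ∀ i, 2 ≤ i.val → m i = 0) : torusPairing m (translationS' (n + 1) α β) ≠ 0 := by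
  have hsum : torusPairing m (translationS' (n + 1) α β) = m 0 • α + m 1 • β := by
    rw [torusPairing, Fin.sum_univ_succ, Fin.sum_univ_succ, Finset.sum_eq_zero]
    · simp [translationS']
    · intro i _
      rw [h i.succ.succ (by simp), zero_smul]
  rw [hsum]
  intro h0
  obtain ⟨h1, h2⟩ := LinearIndependent.pair_iff.1 hαβ _ _ h0
  apply hm
  ext i
  rcases Nat.lt_or_ge i.val 2 with hi | hi
  · have : i = 0 ∨ i = 1 := by
      rcases Nat.lt_succ_iff_lt_or_eq.1 hi with h' | h'
      · exact Or.inl (Fin.ext (by simpa using h'))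
      · exact Or.inr (Fin.ext (by simpa using h'))
    rcases this with rfl | rfl
    · exact h1
    · exact h2
  · exact h i hi

theorem mainTheorem6 (k : ℕ) (hk : 1 ≤ k) (α : Torus) (hα : IsIrrationalPoint α) :
    (∀ j : ℕ, 0 < j → j ≤ k →
      ∃ f : Torus → Torus,
        IsMeasNotContCoboundary (volume : Measure Torus) (circleRotation α) f ∧
        IsStrictlyErgodic (volume : Measure (Fin k → Torus)) (skewT α f j) ∧
        MeasurablyIsomorphic (volume : Measure (Fin k → Torus)) (skewT α f j)
          (volume : Measure (Fin k → Torus)) (affineS α)) ∧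
    (∀ β : Torus, IsIrrationalPoint β →
      ∃ g : Torus → Torus,
        IsMeasNotContCoboundary (volume : Measure Torus) (circleRotation α) g ∧
        (LinearIndependent ℤ ![α, β] →
          IsStrictlyErgodic (volume : Measure (Fin (k + 1) → Torus)) (skewR α β g)) ∧
        MeasurablyIsomorphic (volume : Measure (Fin (k + 1) → Torus)) (skewR α β g)
          (volume : Measure (Fin (k + 1) → Torus)) (affineS' α β)) := by
  obtain ⟨n, rfl⟩ : ∃ n, k = n + 1 := ⟨k - 1, by omega⟩
  have hα' := zsmul_ne_zero_of_isIrrationalPoint hα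
  -- Depth `n + 1` meets `hK` for `n + 1` coordinates and any `j`, and exactly for `n + 2`
  -- coordinates with `j = 1`.
  obtain ⟨f, F, hf, hF, hfF⟩ := exists_iterated_isMeasNotContCoboundary hα' n
  refine ⟨fun j hj _ => ⟨f, hf, ?_⟩, fun β _ => ⟨f, hf, ?_⟩⟩
  · rw [skewT_eq, affineS_eq]
    obtain ⟨h1, h2⟩ := skewUnipotent_single (n := n) (K := n + 1) (a := Pi.single 0 α) le_rfl hj
      (by omega) (by omega) (by omega) hf.continuous hF (by simpa using hfF)
    exact ⟨h2 (torusPairing_single_ne_zero hα'), h1⟩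
  · rw [skewR_eq, affineS'_eq]
    obtain ⟨h1, h2⟩ := skewUnipotent_single (n := n + 1) (s := 2) (j := 1) (K := n + 1)
      (a := translationS' (n + 1) α β) (by omega) (by omega) le_rfl (by omega) (by omega)
      hf.continuous hF (by simpa [translationS'] using hfF)
    exact ⟨fun hαβ => h2 (torusPairing_translationS'_ne_zero hαβ), h1⟩
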